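/- All graphs are finite and simple. The competition graph $C(D)$ of a digraph $D$ is the graph on the vertex set of $D$ in which two distinct vertices $x,y$ are adjacent if and only if there is a vertex $v$ such that $(x,v)$ and $(y,v)$ are arcs of $D$. The competition number $k(G)$ of a graph $G$ is the smallest integer $k\ge 0$ such that the disjoint union of $G$ and $k$ isolated vertices is the competition graph of an acyclic digraph. A hole of $G$ is a cycle of length at least $4$ in $G$ that is an induced subgraph of $G$; $h(G)$ denotes the number of holes of $G$. The clique number $\omega(G)$ is the maximum number of vertices of a clique in $G$. Theorem. Let $G$ be a connected graph. Suppose that the holes of $G$ are pairwise edge-disjoint and that $G$ has at most one (inclusion-)maximal clique with at least $3$ vertices. If $2\le\omega(G)\le h(G)+1$, then $k(G)\le h(G)-\omega(G)+3$. -/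

import Mathlib

namespace HolesCompetition

/-- A digraph is acyclic if it has no directed cycle (in particular no loop), that is, no vertex
is reachable from itself by a directed walk of positive length. -/
def DigraphIsAcyclic {W : Type*} (D : Digraph W) : Prop :=
  ∀ v : W, ¬ Relation.TransGen D.Adj v v

/-- The competition graph `C(D)`: distinct vertices `x`, `y` are adjacent iff they have a common
out-neighbour in `D`. -/
def competitionGraph {W : Type*} (D : Digraph W) : SimpleGraph W where
  Adj x y := x ≠ y ∧ ∃ v : W, D.Adj x v ∧ D.Adj y v
  symm := ⟨fun _ _ h => ⟨h.1.symm, h.2.imp fun _ hv => ⟨hv.2, hv.1⟩⟩⟩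
  loopless := ⟨fun _ h => h.1 rfl⟩

/-- `G` together with `k` new isolated vertices is the competition graph of an acyclic digraph. -/
def IsCompetitionWith {V : Type*} (G : SimpleGraph V) (k : ℕ) : Prop :=
  ∃ D : Digraph (V ⊕ Fin k),
    DigraphIsAcyclic D ∧ competitionGraph D = G.sum (⊥ : SimpleGraph (Fin k))

/-- A finite graph with sufficiently many isolated vertices added is the competition graph of an
acyclic digraph, so that the minimum defining the competition number exists. -/
theorem exists_isCompetitionWith {V : Type*} [Finite V] (G : SimpleGraph V) :
    ∃ k : ℕ, IsCompetitionWith G k := by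
  classical
  obtain ⟨k, ⟨e⟩⟩ := Finite.exists_equiv_fin G.edgeSet
  refine ⟨k, ⟨fun a b => ∃ x i, a = .inl x ∧ b = .inr i ∧ x ∈ (e.symm i : Sym2 V)⟩, ?_, ?_⟩
  · intro v hv
    obtain ⟨x, i, h1, -⟩ := Relation.TransGen.head'_iff.1 hv |>.choose_spec.1
    obtain ⟨y, j, -, h2, -⟩ := Relation.TransGen.tail'_iff.1 hv |>.choose_spec.2
    rw [h1] at h2
    cases h2
  · ext a b
    constructor
    · rintro ⟨hne, v, ⟨x, i, rfl, rfl, hx⟩, ⟨y, j, rfl, hj, hy⟩⟩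
      cases hj
      have hxy : x ≠ y := fun h => hne (by rw [h])
      have h := (e.symm i).2
      rw [(Sym2.mem_and_mem_iff hxy).1 ⟨hx, hy⟩] at h
      simpa using h
    · intro h
      rcases a with x | i <;> rcases b with y | j
      · have h' : G.Adj x y := by simpa using h
        refine ⟨fun hh => h'.ne (Sum.inl.inj hh), .inr (e ⟨s(x, y), h'⟩), ?_, ?_⟩
        · exact ⟨x, _, rfl, rfl, by simp⟩
        · exact ⟨y, _, rfl, rfl, by simp⟩
      all_goals simp at h

open Classical in
/-- The competition number `k(G)` of a finite graph `G`: the smallest `k` such that `G` together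
with `k` isolated vertices is the competition graph of an acyclic digraph. -/
noncomputable def competitionNumber {V : Type*} [Finite V] (G : SimpleGraph V) : ℕ :=
  Nat.find (exists_isCompetitionWith G)

/-- A subgraph of `G` is a hole if it is a chordless cycle of length at least `4`. -/
def IsHole {V : Type*} {G : SimpleGraph V} (H : G.Subgraph) : Prop :=
  ∃ (u : V) (c : G.Walk u u), c.IsCycle ∧ 4 ≤ c.length ∧ c.IsChordless ∧ c.toSubgraph = H

/-- The number `h(G)` of holes of `G`, holes being counted as subgraphs. -/
noncomputable def numHoles {V : Type*} (G : SimpleGraph V) : ℕ :=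
  {H : G.Subgraph | IsHole H}.ncard

/-- Any two distinct holes of `G` have no common edge. -/
def HolesEdgeDisjoint {V : Type*} (G : SimpleGraph V) : Prop :=
  ∀ H₁ H₂ : G.Subgraph, IsHole H₁ → IsHole H₂ → H₁ ≠ H₂ → Disjoint H₁.edgeSet H₂.edgeSet

/-- `K` is (the vertex set of) a non-edge maximal clique: a clique that is maximal under inclusion
and has at least three vertices. -/
def IsNonEdgeMaximalClique {V : Type*} (G : SimpleGraph V) (K : Finset V) : Prop :=
  Maximal (fun s : Finset V => G.IsClique (s : Set V)) K ∧ 3 ≤ K.card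

end HolesCompetition

namespace HolesCompetition

section Potential

variable {V : Type*} {G : SimpleGraph V}

/-- The sum of an edge labelling along a walk. -/
def walkSum (f : Sym2 V → ZMod 2) {u v : V} (p : G.Walk u v) : ZMod 2 :=
  (p.edges.map f).sum

variable (f : Sym2 V → ZMod 2)

@[simp] theorem walkSum_nil (u : V) : walkSum f (SimpleGraph.Walk.nil : G.Walk u u) = 0 := by
  simp [walkSum]

@[simp] theorem walkSum_cons {u v w : V} (h : G.Adj u v) (p : G.Walk v w) :
    walkSum f (.cons h p) = f s(u, v) + walkSum f p := by
  simp [walkSum]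

@[simp] theorem walkSum_append {u v w : V} (p : G.Walk u v) (q : G.Walk v w) :
    walkSum f (p.append q) = walkSum f p + walkSum f q := by
  simp [walkSum]

@[simp] theorem walkSum_reverse {u v : V} (p : G.Walk u v) :
    walkSum f p.reverse = walkSum f p := by
  simp [walkSum, List.sum_reverse]

theorem walkSum_rotate [DecidableEq V] {u v : V} (c : G.Walk u u) (h : v ∈ c.support) :
    walkSum f (c.rotate v h) = walkSum f c :=
  ((c.rotate_edges v h).perm.map f).sum_eq

theorem walkSum_bypass [DecidableEq V] {n : ℕ}
    (hn : ∀ (u : V) (c : G.Walk u u), c.length ≤ n → walkSum f c = 0) {u v : V} (p : G.Walk u v)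
    (hp : p.length ≤ n) : walkSum f p.bypass = walkSum f p := by
  induction p with
  | nil => simp [SimpleGraph.Walk.bypass]
  | @cons u v w h p ih =>
    rw [SimpleGraph.Walk.length_cons] at hp
    have ih := ih (by lia)
    have hl := p.length_bypass_le_length
    rw [SimpleGraph.Walk.bypass]
    split_ifs with hs
    · have h1 := hn u (.cons h (p.bypass.takeUntil u hs))
        (by rw [SimpleGraph.Walk.length_cons]
            have := p.bypass.length_takeUntil_le_length hs
            lia)
      have h2 := congrArg (walkSum f) (p.bypass.take_spec hs)
      rw [walkSum_append] at h2
      rw [walkSum_cons] at h1 ⊢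
      rw [← ih, ← h2, ← add_assoc, h1, zero_add]
    · rw [walkSum_cons, walkSum_cons, ih]

/-- An edge labelling that sums to zero on all triangles and on all chordless cycles of length at
least four sums to zero on all closed walks. -/
theorem walkSum_closed_eq_zero
    (htri : ∀ a b c : V, G.Adj a b → G.Adj b c → G.Adj c a →
      f s(a, b) + (f s(b, c) + f s(c, a)) = 0)
    (hhole : ∀ (u : V) (c : G.Walk u u), c.IsCycle → 4 ≤ c.length → c.IsChordless →
      walkSum f c = 0) {u : V} (c : G.Walk u u) : walkSum f c = 0 := by
  classical
  suffices H : ∀ n, ∀ (u : V) (c : G.Walk u u), c.length ≤ n → walkSum f c = 0 from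
    H _ u c le_rfl
  intro n
  induction n with
  | zero =>
    intro u c hc
    cases c with
    | nil => simp
    | cons h p => simp at hc
  | succ n ih =>
    intro u c hc
    cases c with
    | nil => simp
    | @cons _ v _ h p =>
    rw [SimpleGraph.Walk.length_cons] at hc
    have hbp := walkSum_bypass f ih p (by lia)
    have hbl := p.length_bypass_le_length
    have hpath := p.bypass_isPath
    rw [walkSum_cons, ← hbp]
    generalize p.bypass = q at hbl hpath ⊢
    by_cases he : s(u, v) ∈ q.edges
    · cases q with
      | nil => simp at he
      | @cons _ x _ h' q =>
      rw [SimpleGraph.Walk.cons_isPath_iff] at hpath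
      rw [SimpleGraph.Walk.edges_cons, List.mem_cons] at he
      rcases he with he | he
      · have hxu : u = x := by
          rcases Sym2.eq_iff.1 he with ⟨rfl, rfl⟩ | ⟨rfl, -⟩
          · exact absurd h (G.irrefl)
          · rfl
        subst hxu
        rw [(SimpleGraph.Walk.isPath_iff_nil.1 hpath.1).eq_nil, walkSum_cons, walkSum_nil, add_zero,
          Sym2.eq_swap]
        exact CharTwo.add_self_eq_zero _
      · exact absurd (q.snd_mem_support_of_mem_edges he) hpath.2
    · have hcyc : (SimpleGraph.Walk.cons h q).IsCycle := (q.cons_isCycle_iff h).2 ⟨hpath, he⟩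
      rw [← walkSum_cons f h q]
      have hlen : (SimpleGraph.Walk.cons h q).length ≤ n + 1 := by
        rw [SimpleGraph.Walk.length_cons]; lia
      have h3 := hcyc.three_le_length
      clear hc he hbl hbp hpath p
      rcases h3.lt_or_eq with h4 | h3
      · generalize SimpleGraph.Walk.cons h q = c at *
        by_cases hch : c.IsChordless
        · exact hhole u c hcyc h4 hch
        · obtain ⟨a, b, ha, hb, hab, hnot⟩ : ∃ a b, a ∈ c.support ∧ b ∈ c.support ∧ G.Adj a b ∧
              s(a, b) ∉ c.edges := by
            rw [SimpleGraph.Walk.isChordless_iff_forall_mem_edges] at hch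
            push Not at hch
            grind
          have hmem : b ∈ (c.rotate a ha).support := by
            rw [SimpleGraph.Walk.mem_support_rotate_iff]; exact hb
          have hlr : (c.rotate a ha).length = c.length := SimpleGraph.Walk.length_rotate ..
          have hnot' : s(a, b) ∉ (c.rotate a ha).edges := fun hh =>
            hnot ((c.rotate_edges a ha).mem_iff.1 hh)
          rw [← walkSum_rotate f c ha]
          generalize c.rotate a ha = d at *
          have hd := d.take_spec hmem
          generalize d.takeUntil b hmem = t at *
          generalize d.dropUntil b hmem = s at *
          subst hd
          rw [SimpleGraph.Walk.length_append] at hlr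
          rw [SimpleGraph.Walk.edges_append, List.mem_append, not_or] at hnot'
          have ht : 2 ≤ t.length := by
            rcases t with _ | ⟨h1, _ | ⟨h2, t⟩⟩
            · exact absurd hab G.irrefl
            · simp at hnot'
            · simp
          have hs : 2 ≤ s.length := by
            rcases s with _ | ⟨h1, _ | ⟨h2, s⟩⟩
            · exact absurd hab G.irrefl
            · simp [Sym2.eq_swap] at hnot'
            · simp
          have e1 := ih b (.cons hab.symm t) (by rw [SimpleGraph.Walk.length_cons]; lia)
          have e2 := ih a (.cons hab s) (by rw [SimpleGraph.Walk.length_cons]; lia)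
          rw [walkSum_cons] at e1 e2
          rw [Sym2.eq_swap] at e1
          rw [walkSum_append]
          have e3 := CharTwo.add_self_eq_zero (f s(a, b))
          linear_combination e1 + e2 - e3
      · rcases q with _ | ⟨h1, _ | ⟨h2, _ | ⟨h4, q⟩⟩⟩ <;> simp at h3
        simpa using htri _ _ _ h h1 h2

/-- A labelling of the edges of a connected graph that sums to zero on all triangles and on all
chordless cycles of length at least four is the coboundary of a vertex labelling. -/
theorem exists_potential (hG : G.Connected)
    (htri : ∀ a b c : V, G.Adj a b → G.Adj b c → G.Adj c a →
      f s(a, b) + (f s(b, c) + f s(c, a)) = 0)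
    (hhole : ∀ (u : V) (c : G.Walk u u), c.IsCycle → 4 ≤ c.length → c.IsChordless →
      walkSum f c = 0) (r : V) (x : ZMod 2) :
    ∃ φ : V → ZMod 2, φ r = x ∧ ∀ a b, G.Adj a b → f s(a, b) = φ a + φ b := by
  choose P _ using fun v => hG.preconnected.exists_isPath r v
  refine ⟨fun v => x + walkSum f (P v), ?_, fun a b hab => ?_⟩
  · simp [walkSum_closed_eq_zero f htri hhole]
  · have h := walkSum_closed_eq_zero f htri hhole ((P a).append (.cons hab (P b).reverse))
    simp only [walkSum_append, walkSum_cons, walkSum_reverse] at h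
    have e1 := CharTwo.add_self_eq_zero (walkSum f (P a))
    have e2 := CharTwo.add_self_eq_zero (walkSum f (P b))
    have e3 := CharTwo.add_self_eq_zero x
    linear_combination h - e1 - e2 - e3

/-- The coboundary of a vertex labelling. -/
def coboundary (φ : V → ZMod 2) : Sym2 V → ZMod 2 :=
  Sym2.lift ⟨fun a b => φ a + φ b, fun _ _ => add_comm _ _⟩

@[simp] theorem coboundary_mk (φ : V → ZMod 2) (a b : V) : coboundary φ s(a, b) = φ a + φ b := rfl

theorem walkSum_coboundary (φ : V → ZMod 2) {u v : V} (p : G.Walk u v) :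
    walkSum (coboundary φ) p = φ u + φ v := by
  induction p with
  | nil => simp [CharTwo.add_self_eq_zero]
  | @cons a b c h p ih =>
    rw [walkSum_cons, ih, coboundary_mk]
    linear_combination CharTwo.add_self_eq_zero (φ b)

end Potential

end HolesCompetition
namespace HolesCompetition

section Count

variable {V : Type*} [Fintype V] {G : SimpleGraph V}

open Classical in
/-- The sum of an edge labelling over the edges of a subgraph. -/
noncomputable def subgraphSum (f : Sym2 V → ZMod 2) (H : G.Subgraph) : ZMod 2 :=
  ∑ e with e ∈ H.edgeSet, f e

theorem subgraphSum_toSubgraph (f : Sym2 V → ZMod 2) {u v : V} {p : G.Walk u v}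
    (hp : p.IsTrail) : subgraphSum f p.toSubgraph = walkSum f p := by
  classical
  rw [walkSum, ← List.sum_toFinset f hp.edges_nodup, subgraphSum]
  refine Finset.sum_congr ?_ fun _ _ => rfl
  ext e
  simp

theorem subgraphSum_coboundary (φ : V → ZMod 2) {H : G.Subgraph} (hH : IsHole H) :
    subgraphSum (coboundary φ) H = 0 := by
  obtain ⟨u, c, hc, -, -, rfl⟩ := hH
  rw [subgraphSum_toSubgraph _ hc.isTrail, walkSum_coboundary, CharTwo.add_self_eq_zero]

open Classical in
/-- The edges of `G` that do not lie inside `K`. -/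
noncomputable def edgesOutside (G : SimpleGraph V) (K : Finset V) : Finset (Sym2 V) :=
  {e | e ∈ G.edgeSet ∧ ∃ x ∈ e, x ∉ K}

theorem mem_edgesOutside {K : Finset V} {e : Sym2 V} :
    e ∈ edgesOutside G K ↔ e ∈ G.edgeSet ∧ ∃ x ∈ e, x ∉ K := by
  simp [edgesOutside]

/-- A hole has an edge that does not lie inside a given clique. -/
theorem IsHole.exists_mem_edgesOutside {K : Finset V} (hK : G.IsClique (K : Set V))
    {H : G.Subgraph} (hH : IsHole H) : ∃ e ∈ H.edgeSet, e ∈ edgesOutside G K := by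
  classical
  obtain ⟨u, c, hc, h4, hch, rfl⟩ := hH
  by_contra! hno
  have hsub : ∀ x ∈ c.support, x ∈ K := by
    intro x hx
    by_contra hxK
    have hne : (c.toSubgraph.neighborSet x).ncard ≠ 0 := by
      rw [hc.ncard_neighborSet_toSubgraph_eq_two hx]; simp
    obtain ⟨y, hy⟩ := Set.nonempty_of_ncard_ne_zero hne
    exact hno s(x, y) hy (mem_edgesOutside.2 ⟨c.toSubgraph.adj_sub hy, x, by simp, hxK⟩)
  have hcard : c.support.tail.toFinset.card = c.length := by
    rw [List.toFinset_card_of_nodup hc.support_nodup]; simp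
  have hle : (c.support.tail.toFinset.erase u : Set V) ⊆ c.toSubgraph.neighborSet u := by
    intro x hx
    simp only [Finset.coe_erase, List.coe_toFinset, Set.mem_sdiff, Set.mem_ofPred_eq,
      Set.mem_singleton_iff] at hx
    have hxs := List.mem_of_mem_tail hx.1
    exact SimpleGraph.Walk.adj_toSubgraph_iff_mem_edges.2 (hch.mem_edges c.start_mem_support hxs
      (hK (hsub _ c.start_mem_support) (hsub _ hxs) (Ne.symm hx.2)))
  have h1 := Set.ncard_le_ncard hle (Set.toFinite _)
  rw [Set.ncard_coe_finset, hc.ncard_neighborSet_toSubgraph_eq_two c.start_mem_support] at h1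
  have h2 := Finset.pred_card_le_card_erase (s := c.support.tail.toFinset) (a := u)
  lia

/-- In a connected graph with pairwise edge-disjoint holes and a clique that contains all
triangles, the number of holes determines the number of edges. -/
theorem card_add_numHoles (hG : G.Connected) (hdisj : HolesEdgeDisjoint G) {K : Finset V}
    (hK : G.IsClique (K : Set V)) (hne : K.Nonempty)
    (htri : ∀ a b c : V, G.Adj a b → G.Adj b c → G.Adj c a → a ∈ K) :
    Fintype.card V + numHoles G = K.card + (edgesOutside G K).card := by
  classical
  let := Fintype.ofFinite {H : G.Subgraph // IsHole H}
  have hnum : numHoles G = Fintype.card {H : G.Subgraph // IsHole H} := by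
    rw [← Nat.card_eq_fintype_card]; rfl
  choose rep hrep hrepK using fun H : {H : G.Subgraph // IsHole H} =>
    H.2.exists_mem_edgesOutside hK
  have hrepmem : ∀ H H', rep H' ∈ H.1.edgeSet ↔ H' = H := by
    refine fun H H' => ⟨fun h => ?_, fun h => h ▸ hrep _⟩
    by_contra hn
    exact Set.disjoint_left.1 (hdisj _ _ H'.2 H.2 fun hh => hn (Subtype.ext hh)) (hrep H') h
  have hinj : Function.Injective rep := fun H H' h => ((hrepmem H' H).1 (h ▸ hrep H'))
  set C := Finset.univ.image rep with hC
  have hCsub : C ⊆ edgesOutside G K := by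
    intro e he
    obtain ⟨H, -, rfl⟩ := Finset.mem_image.1 he
    exact hrepK H
  have hCcard : C.card = numHoles G := by
    rw [hC, Finset.card_image_of_injective _ hinj, hnum, Finset.card_univ]
  let Φ : (V → ZMod 2) → (K → ZMod 2) × ((edgesOutside G K \ C : Finset (Sym2 V)) → ZMod 2) :=
    fun φ => (fun k => φ k, fun e => coboundary φ e)
  obtain ⟨r, hr⟩ := hne
  have hΦinj : Function.Injective Φ := by
    intro φ φ' h
    have hk : ∀ k ∈ K, φ k = φ' k := fun k hk => congrFun (congrArg Prod.fst h) ⟨k, hk⟩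
    have he : ∀ e ∈ edgesOutside G K \ C, coboundary φ e = coboundary φ' e :=
      fun e he => congrFun (congrArg Prod.snd h) ⟨e, he⟩
    have hne : ∀ e ∈ G.edgeSet, e ∉ C → coboundary φ e = coboundary φ' e := by
      intro e heG heC
      by_cases heK : e ∈ edgesOutside G K
      · exact he e (Finset.mem_sdiff.2 ⟨heK, heC⟩)
      · induction e with | _ a b =>
        rw [mem_edgesOutside] at heK
        push Not at heK
        rw [coboundary_mk, coboundary_mk, hk a (heK heG a (by simp)),
          hk b (heK heG b (by simp))]
    have hall : ∀ e ∈ G.edgeSet, coboundary φ e = coboundary φ' e := by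
      intro e heG
      by_cases heC : e ∈ C
      · obtain ⟨H, -, rfl⟩ := Finset.mem_image.1 heC
        have h1 := (subgraphSum_coboundary φ H.2).trans (subgraphSum_coboundary φ' H.2).symm
        have hm : rep H ∈ Finset.univ.filter (fun e => e ∈ H.1.edgeSet) := by simpa using hrep H
        rw [subgraphSum, subgraphSum, ← Finset.add_sum_erase _ _ hm,
          ← Finset.add_sum_erase _ (coboundary φ') hm] at h1
        refine add_right_cancel (h1.trans (congrArg _ (Finset.sum_congr rfl fun e he => ?_)).symm)
        simp only [Finset.mem_erase, Finset.mem_filter, Finset.mem_univ, true_and] at he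
        refine hne e (H.1.edgeSet_subset he.2) fun heC => he.1 ?_
        obtain ⟨H', -, rfl⟩ := Finset.mem_image.1 heC
        rw [(hrepmem H H').1 he.2]
      · exact hne e heG heC
    funext v
    obtain ⟨p⟩ := hG.preconnected r v
    have hp : walkSum (coboundary φ) p = walkSum (coboundary φ') p :=
      congrArg List.sum (List.map_congr_left fun e he => hall e (p.edges_subset_edgeSet he))
    rw [walkSum_coboundary, walkSum_coboundary, hk r hr] at hp
    exact add_left_cancel hp
  have hΦsurj : Function.Surjective Φ := by
    rintro ⟨ψ, g⟩
    let ψ' : V → ZMod 2 := fun v => if h : v ∈ K then ψ ⟨v, h⟩ else 0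
    let g₀ : Sym2 V → ZMod 2 := fun e =>
      if e ∈ edgesOutside G K then
        if h : e ∈ edgesOutside G K \ C then g ⟨e, h⟩ else 0
      else coboundary ψ' e
    let f : Sym2 V → ZMod 2 := fun e =>
      g₀ e + ∑ H : {H : G.Subgraph // IsHole H}, if e = rep H then subgraphSum g₀ H.1 else 0
    have hf : ∀ e, e ∉ C → f e = g₀ e := by
      intro e he
      have : ∀ H : {H : G.Subgraph // IsHole H}, e ≠ rep H := by
        rintro H rfl
        exact he (Finset.mem_image_of_mem _ (Finset.mem_univ _))
      simp [f, this]
    have hfK : ∀ a ∈ K, ∀ b ∈ K, f s(a, b) = ψ' a + ψ' b := by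
      intro a ha b hb
      have hnot : s(a, b) ∉ edgesOutside G K := by
        rw [mem_edgesOutside]
        rintro ⟨-, x, hx, hxK⟩
        rcases Sym2.mem_iff.1 hx with rfl | rfl <;> exact hxK (by assumption)
      rw [hf _ fun h => hnot (hCsub h)]
      simp [g₀, hnot]
    have hfhole : ∀ H : G.Subgraph, IsHole H → subgraphSum f H = 0 := by
      intro H hH
      have : ∀ H' : {H : G.Subgraph // IsHole H},
          (∑ e with e ∈ H.edgeSet, if e = rep H' then subgraphSum g₀ H'.1 else 0) =
            if H' = ⟨H, hH⟩ then subgraphSum g₀ H else 0 := by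
        intro H'
        rw [Finset.sum_ite_eq']
        simp only [Finset.mem_filter, Finset.mem_univ, true_and, hrepmem ⟨H, hH⟩ H']
        split_ifs with h
        · rw [h]
        · rfl
      rw [subgraphSum, Finset.sum_add_distrib, Finset.sum_comm, Finset.sum_congr rfl
        fun H' _ => this H', Finset.sum_ite_eq']
      simp only [Finset.mem_univ, if_true]
      exact CharTwo.add_self_eq_zero (subgraphSum g₀ H)
    obtain ⟨φ, hφr, hφ⟩ := exists_potential f hG
      (fun a b c hab hbc hca => by
        have ha := htri a b c hab hbc hca
        have hb := htri b c a hbc hca hab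
        have hc := htri c a b hca hab hbc
        rw [hfK a ha b hb, hfK b hb c hc, hfK c hc a ha]
        linear_combination CharTwo.add_self_eq_zero (ψ' a) + CharTwo.add_self_eq_zero (ψ' b) +
          CharTwo.add_self_eq_zero (ψ' c))
      (fun u c hc h4 hch => by
        rw [← subgraphSum_toSubgraph f hc.isTrail]
        exact hfhole _ ⟨u, c, hc, h4, hch, rfl⟩) r (ψ' r)
    refine ⟨φ, Prod.ext (funext fun k => ?_) (funext fun e => ?_)⟩
    · suffices h : φ k = ψ' k by simpa [ψ'] using h
      by_cases hk : r = k
      · rw [← hk, hφr]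
      · have h1 := hφ r k (hK hr k.2 hk)
        rw [hfK r hr k k.2, hφr] at h1
        exact (add_left_cancel h1).symm
    · obtain ⟨e, he⟩ := e
      have he' := Finset.mem_sdiff.1 he
      have h1 : coboundary φ e = f e := by
        induction e with | _ a b =>
        exact (hφ a b (mem_edgesOutside.1 he'.1).1).symm
      change coboundary φ e = _
      rw [h1, hf e he'.2]
      simp [g₀, he'.1, he'.2]
  have hcard := Fintype.card_of_bijective ⟨hΦinj, hΦsurj⟩
  rw [Fintype.card_prod, Fintype.card_fun, Fintype.card_fun, Fintype.card_fun, ZMod.card,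
    Fintype.card_coe, Fintype.card_coe, ← pow_add] at hcard
  have hcard := Nat.pow_right_injective le_rfl hcard
  rw [Finset.card_sdiff_of_subset hCsub] at hcard
  have := Finset.card_le_card hCsub
  lia

end Count

end HolesCompetition
namespace HolesCompetition

section Ordering

variable {V : Type*}

theorem sum_card_filter_mem [DecidableEq V] (E : Finset (Sym2 V)) (S : Finset V)
    (hloop : ∀ e ∈ E, ¬ e.IsDiag) (hS : ∀ e ∈ E, ∀ x ∈ e, x ∈ S) :
    ∑ v ∈ S, (E.filter (v ∈ ·)).card = 2 * E.card := by
  have h := Finset.sum_card_bipartiteAbove_eq_sum_card_bipartiteBelow (s := S) (t := E)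
    (fun v e => v ∈ e)
  simp only [Finset.bipartiteAbove, Finset.bipartiteBelow] at h
  rw [h, mul_comm, ← smul_eq_mul]
  refine Finset.sum_const_nat fun e he => ?_
  rw [← Sym2.card_toFinset_of_not_isDiag e (hloop e he)]
  congr 1
  ext x
  simp only [Finset.mem_filter, Sym2.mem_toFinset, and_iff_right_iff_imp]
  exact hS e he x

/-- If a loopless set of edges on a vertex set `S` has at least `|S| - 1` elements, then the
vertices can be numbered injectively by `0, …, |S| - 1` and the edges injectively by `2, 3, …` such
that each edge has a greater number than its ends. -/
theorem exists_numbering [DecidableEq V] (n : ℕ) (E : Finset (Sym2 V)) (S : Finset V)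
    (hloop : ∀ e ∈ E, ¬ e.IsDiag) (hS : ∀ e ∈ E, ∀ x ∈ e, x ∈ S) (hn : S.card = n + 1)
    (hE : n ≤ E.card) :
    ∃ (r : V → ℕ) (p : Sym2 V → ℕ), Set.InjOn r S ∧ (∀ x ∈ S, r x < S.card) ∧
      Set.InjOn p E ∧ (∀ e ∈ E, p e < E.card + 2) ∧ ∀ e ∈ E, ∀ x ∈ e, r x < p e := by
  induction n generalizing E S with
  | zero =>
    obtain ⟨v, rfl⟩ := Finset.card_eq_one.1 hn
    have hE : E = ∅ := by
      refine Finset.eq_empty_of_forall_notMem fun e he => ?_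
      have h1 := hloop e he
      have h2 := hS e he
      induction e with | _ a b =>
      simp only [Finset.mem_singleton] at h2
      exact h1 ((h2 a (by simp)).trans (h2 b (by simp)).symm)
    subst hE
    exact ⟨fun _ => 0, fun _ => 0, by simp, by simp, by simp, by simp, by simp⟩
  | succ n ih =>
    have hne : S.Nonempty := Finset.card_pos.1 (by lia)
    obtain ⟨v, hv, hmin⟩ := S.exists_min_image (fun v => (E.filter (v ∈ ·)).card) hne
    set A := E.filter (v ∈ ·) with hA
    set B := E.filter (v ∉ ·) with hB
    have hAB : A.card + B.card = E.card := Finset.card_filter_add_card_filter_not _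
    have hdeg : S.card * A.card ≤ 2 * E.card := by
      rw [← sum_card_filter_mem E S hloop hS, ← smul_eq_mul]
      exact Finset.card_nsmul_le_sum _ _ _ hmin
    have hnB : n ≤ B.card := by
      rcases le_or_gt A.card 1 with h1 | h1
      · lia
      · rw [hn] at hdeg
        nlinarith
    have hcard : (S.erase v).card = n + 1 := by rw [Finset.card_erase_of_mem hv]; lia
    obtain ⟨r, p, hr, hrlt, hp, hplt, hrp⟩ := ih B (S.erase v)
      (fun e he => hloop e (Finset.mem_filter.1 he).1)
      (fun e he x hx => by
        obtain ⟨h1, h2⟩ := Finset.mem_filter.1 he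
        exact Finset.mem_erase.2 ⟨fun h => h2 (h ▸ hx), hS e h1 x hx⟩) hcard hnB
    obtain ⟨idx, hidxlt, hidx⟩ : ∃ idx : Sym2 V → ℕ, (∀ e ∈ A, idx e < A.card) ∧
        Set.InjOn idx A := by
      refine ⟨fun e => if h : e ∈ A then A.equivFin ⟨e, h⟩ else 0, fun e he => ?_, ?_⟩
      · simp [he]
      · intro e he e' he' h
        have he : e ∈ A := he
        have he' : e' ∈ A := he'
        simpa [he, he', Fin.val_inj] using h
    have hsplit : ∀ e ∈ E, e ∈ A ∨ v ∉ e ∧ e ∈ B := by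
      intro e he
      by_cases h : v ∈ e <;> simp [hA, hB, h, he]
    have hAv : ∀ e ∈ A, v ∈ e := fun e he => (Finset.mem_filter.1 he).2
    have hAS : ∀ e ∈ A, ∀ x ∈ e, x ∈ S := fun e he => hS e (Finset.mem_filter.1 he).1
    have hrS : ∀ x ∈ S, x ≠ v → r x < n + 1 := fun x hx h =>
      hcard ▸ hrlt x (Finset.mem_erase.2 ⟨h, hx⟩)
    refine ⟨fun x => if x = v then n + 1 else r x,
      fun e => if v ∈ e then B.card + 2 + idx e else p e, ?_, ?_, ?_, ?_, ?_⟩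
    · intro x hx y hy h
      have hx : x ∈ S := hx
      have hy : y ∈ S := hy
      have h1 := hrS x hx
      have h2 := hrS y hy
      dsimp only at h
      split_ifs at h with hxv hyv hyv
      · rw [hxv, hyv]
      · have := h2 hyv; lia
      · have := h1 hxv; lia
      · exact hr (by simp [hx, hxv]) (by simp [hy, hyv]) h
    · intro x hx
      have h1 := hrS x hx
      dsimp only
      split_ifs with hxv
      · lia
      · have := h1 hxv; lia
    · intro e he e' he' h
      dsimp only at h
      rcases hsplit e he with h1 | ⟨h1, h2⟩ <;> rcases hsplit e' he' with h1' | ⟨h1', h2'⟩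
      · rw [if_pos (hAv e h1), if_pos (hAv e' h1')] at h
        exact hidx h1 h1' (by lia)
      · rw [if_pos (hAv e h1), if_neg h1'] at h
        have := hplt e' h2'
        lia
      · rw [if_neg h1, if_pos (hAv e' h1')] at h
        have := hplt e h2
        lia
      · rw [if_neg h1, if_neg h1'] at h
        exact hp h2 h2' h
    · intro e he
      dsimp only
      rcases hsplit e he with h1 | ⟨h1, h2⟩
      · rw [if_pos (hAv e h1)]
        have := hidxlt e h1
        lia
      · rw [if_neg h1]
        have := hplt e h2
        lia
    · intro e he x hx
      dsimp only
      rcases hsplit e he with h1 | ⟨h1, h2⟩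
      · rw [if_pos (hAv e h1)]
        have := hrS x (hAS e h1 x hx)
        split_ifs with hxv
        · lia
        · have := this hxv; lia
      · rw [if_neg h1, if_neg fun h : x = v => h1 (h ▸ hx)]
        exact hrp e h2 x hx

end Ordering

section Digraph

variable {V : Type*} [Fintype V] {G : SimpleGraph V}

theorem isCompetitionWith_of_isClique [Nonempty V] {K : Finset V} (hK : G.IsClique (K : Set V))
    (hcard : Fintype.card V ≤ (edgesOutside G K).card + 1) :
    IsCompetitionWith G ((edgesOutside G K).card + 3 - Fintype.card V) := by
  classical
  have hEG : ∀ e ∈ edgesOutside G K, e ∈ G.edgeSet := fun e he => (mem_edgesOutside.1 he).1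
  have hpos : 0 < Fintype.card V := Fintype.card_pos
  obtain ⟨r, p, hr, hrlt, hp, hplt, hrp⟩ := exists_numbering (Fintype.card V - 1)
    (edgesOutside G K) Finset.univ (fun e he => G.not_isDiag_of_mem_edgeSet (hEG e he))
    (by simp) (by rw [Finset.card_univ]; lia) (by lia)
  replace hr : Function.Injective r := by simpa [Set.injOn_univ] using hr
  simp only [Finset.mem_univ, forall_true_left, Finset.card_univ] at hrlt
  set n := Fintype.card V
  set N := (edgesOutside G K).card
  have hrbij : ∀ m < n, ∃ x, r x = m := by
    have h : Function.Bijective fun x => (⟨r x, hrlt x⟩ : Fin n) :=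
      (Fintype.bijective_iff_injective_and_card _).2
        ⟨fun x y h => hr (Fin.mk.inj h), by simp [n]⟩
    intro m hm
    obtain ⟨x, hx⟩ := h.2 ⟨m, hm⟩
    exact ⟨x, Fin.mk.inj hx⟩
  let pos : V ⊕ Fin (N + 3 - n) → ℕ := Sum.elim r fun j => n + j
  have hsurj : ∀ m < N + 3, ∃ w, pos w = m := by
    intro m hm
    rcases lt_or_ge m n with h | h
    · obtain ⟨x, hx⟩ := hrbij m h
      exact ⟨.inl x, hx⟩
    · exact ⟨.inr ⟨m - n, by lia⟩, by simp [pos, h]⟩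
  let D : Digraph (V ⊕ Fin (N + 3 - n)) := ⟨fun a b => ∃ x, a = .inl x ∧
    ((∃ e ∈ edgesOutside G K, x ∈ e ∧ pos b = p e) ∨ x ∈ K ∧ pos b = N + 2)⟩
  have hlt : ∀ a b, D.Adj a b → pos a < pos b := by
    rintro _ b ⟨x, rfl, ⟨e, he, hx, hb⟩ | ⟨-, hb⟩⟩
    · rw [hb]; exact hrp e he x hx
    · rw [hb]
      have := hrlt x
      simp only [pos, Sum.elim_inl]
      lia
  refine ⟨D, fun v hv => ?_, ?_⟩
  · have : ∀ a b, Relation.TransGen D.Adj a b → pos a < pos b := by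
      intro a b h
      induction h with
      | single h => exact hlt _ _ h
      | tail _ h ih => exact ih.trans (hlt _ _ h)
    exact lt_irrefl _ (this v v hv)
  · ext a b
    constructor
    · rintro ⟨hab, w, ⟨x, rfl, hx⟩, y, rfl, hy⟩
      have hxy : x ≠ y := fun h => hab (by rw [h])
      change G.Adj x y
      rcases hx with ⟨e, he, hxe, hw⟩ | ⟨hxK, hw⟩ <;>
        rcases hy with ⟨e', he', hye, hw'⟩ | ⟨hyK, hw'⟩
      · have : e = e' := hp he he' (hw.symm.trans hw')
        subst this
        have := hEG e he
        rwa [(Sym2.mem_and_mem_iff hxy).1 ⟨hxe, hye⟩] at this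
      · have := hplt e he; lia
      · have := hplt e' he'; lia
      · exact hK hxK hyK hxy
    · intro h
      rcases a with x | i <;> rcases b with y | j
      · have h' : G.Adj x y := by simpa using h
        refine ⟨fun hh => h'.ne (Sum.inl.inj hh), ?_⟩
        by_cases he : s(x, y) ∈ edgesOutside G K
        · obtain ⟨w, hw⟩ := hsurj (p s(x, y)) (by have := hplt _ he; lia)
          exact ⟨w, ⟨x, rfl, .inl ⟨_, he, by simp, hw⟩⟩, y, rfl, .inl ⟨_, he, by simp, hw⟩⟩
        · rw [mem_edgesOutside] at he
          push Not at he
          obtain ⟨w, hw⟩ := hsurj (N + 2) (by lia)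
          exact ⟨w, ⟨x, rfl, .inr ⟨he h' x (by simp), hw⟩⟩, y, rfl,
            .inr ⟨he h' y (by simp), hw⟩⟩
      all_goals simp at h

/-- If all maximal cliques with at least three vertices coincide, then every clique of maximum size
contains all triangles. -/
theorem mem_of_isNClique_cliqueNum
    (hclique : ∀ K₁ K₂ : Finset V, IsNonEdgeMaximalClique G K₁ →
      IsNonEdgeMaximalClique G K₂ → K₁ = K₂) {K : Finset V} (hK : G.IsNClique G.cliqueNum K)
    (a b c : V) (hab : G.Adj a b) (hbc : G.Adj b c) (hca : G.Adj c a) : a ∈ K := by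
  classical
  have htri : G.IsClique ((({a, b, c} : Finset V)) : Set V) ∧ ({a, b, c} : Finset V).card = 3 := by
    have := SimpleGraph.is3Clique_triple_iff.2 ⟨hab, hca.symm, hbc⟩
    exact ⟨this.isClique, this.card_eq⟩
  obtain ⟨T, hle, hT⟩ := Finite.exists_le_maximal
    (p := fun s : Finset V => G.IsClique (s : Set V)) htri.1
  have h3 : 3 ≤ G.cliqueNum := htri.2 ▸ SimpleGraph.IsClique.card_le_cliqueNum (tc := htri.1)
  have hT3 : 3 ≤ T.card := htri.2 ▸ Finset.card_le_card hle
  have hKmax : Maximal (fun s : Finset V => G.IsClique (s : Set V)) K := by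
    refine ⟨hK.isClique, fun s hs hKs => ?_⟩
    have h1 := SimpleGraph.IsClique.card_le_cliqueNum (tc := hs)
    exact (Finset.eq_of_subset_of_card_le hKs (hK.card_eq.symm ▸ h1)).ge
  rw [hclique K T ⟨hKmax, hK.card_eq.symm ▸ h3⟩ ⟨hT, hT3⟩]
  exact hle (by simp)

end Digraph

end HolesCompetition
theorem theorem2 {V : Type*} [Fintype V] (G : SimpleGraph V) (hconn : G.Connected)
    (hdisj : HolesCompetition.HolesEdgeDisjoint G)
    (hclique : ∀ K₁ K₂ : Finset V, HolesCompetition.IsNonEdgeMaximalClique G K₁ →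
      HolesCompetition.IsNonEdgeMaximalClique G K₂ → K₁ = K₂)
    (hlow : 2 ≤ G.cliqueNum) (hupp : G.cliqueNum ≤ HolesCompetition.numHoles G + 1) :
    (HolesCompetition.competitionNumber G : ℤ) ≤
      (HolesCompetition.numHoles G : ℤ) - (G.cliqueNum : ℤ) + 3 := by
  classical
  obtain ⟨K, hK⟩ := G.exists_isNClique_cliqueNum
  have hne : K.Nonempty := Finset.card_pos.1 (by rw [hK.card_eq]; lia)
  have : Nonempty V := ⟨hne.choose⟩
  have hcount := HolesCompetition.card_add_numHoles hconn hdisj hK.isClique hne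
    (HolesCompetition.mem_of_isNClique_cliqueNum hclique hK)
  rw [hK.card_eq] at hcount
  have hle : HolesCompetition.competitionNumber G ≤ _ := Nat.find_min' _
    (HolesCompetition.isCompetitionWith_of_isClique hK.isClique (by lia))
  lia
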